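/- Let $\mathcal A$ be a locally noetherian Grothendieck category, i.e. a Grothendieck category with a small generating set of noetherian objects. Let $G$ be an arbitrary group acting on $\mathcal A$, i.e. let a group homomorphism be given from $G$ to the group (under composition) of isomorphism classes of autoequivalences of $\mathcal A$. An object $H$ of $\mathcal A$ is monoform if $H\neq 0$ and, for every nonzero subobject $L\subseteq H$, the objects $H$ and $H/L$ have no common nonzero subobject (up to isomorphism). Two monoform objects are atom-equivalent if they have a common nonzero subobject. The atom spectrum $\operatorname{Spec}\mathcal A$ is the set of atom-equivalence classes $\overline H$ of monoform objects $H$, with the topology generated by the sets $$\operatorname{Supp} M=\{\overline H \mid H \text{ a monoform subquotient of } M\},\qquad M\in\mathcal A.$$ The group $G$ acts on $\operatorname{Spec}\mathcal A$ by $g\cdot\overline H=\overline{g\cdot H}$, and the orbit atom spectrum $\operatorname{Spec}^G\mathcal A$ is the quotient space $(\operatorname{Spec}\mathcal A)/G$. Then $\operatorname{Spec}^G\mathcal A$ is a $T_0$-space. By contrast, quotients of $T_0$-spaces by group actions need not be $T_0$: there are a $T_0$-space $X$ and a group acting on $X$ by homeomorphisms such that the orbit space, with the quotient topology, is not a $T_0$-space.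 -/

import Mathlib

open CategoryTheory CategoryTheory.Limits

universe w v u z

namespace OrbitAtom

section Atoms

variable {A : Type u} [Category.{v} A]

/-- `X` and `Y` have a common nonzero subobject: some nonzero object embeds into both. -/
def HasCommonNonzeroSubobject (X Y : A) : Prop :=
  ∃ K : A, ¬ IsZero K ∧ (∃ i : K ⟶ X, Mono i) ∧ (∃ j : K ⟶ Y, Mono j)

/-- `X` is a subquotient of `M`: a quotient of a subobject of `M`. -/
def IsSubquotient (X M : A) : Prop :=
  ∃ (N : A) (i : N ⟶ M) (p : N ⟶ X), Mono i ∧ Epi p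

lemma isZero_of_map {B : Type*} [Category* B] (e : A ≌ B) {X : A}
    (h : IsZero (e.functor.obj X)) : IsZero X := by
  refine ⟨fun Y => ⟨⟨⟨e.functor.preimage (h.to_ _)⟩, fun f => ?_⟩⟩,
    fun Y => ⟨⟨⟨e.functor.preimage (h.from_ _)⟩, fun f => ?_⟩⟩⟩
  · exact e.functor.map_injective (h.eq_of_src _ _)
  · exact e.functor.map_injective (h.eq_of_tgt _ _)

lemma HasCommonNonzeroSubobject.map_equivalence {X Y : A}
    (h : HasCommonNonzeroSubobject X Y) {B : Type*} [Category* B] (e : A ≌ B) :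
    HasCommonNonzeroSubobject (e.functor.obj X) (e.functor.obj Y) := by
  obtain ⟨K, hK, ⟨i, hi⟩, ⟨j, hj⟩⟩ := h
  refine ⟨e.functor.obj K, fun hz => hK ?_, ⟨e.functor.map i, inferInstance⟩,
    ⟨e.functor.map j, inferInstance⟩⟩
  exact isZero_of_map e hz

lemma HasCommonNonzeroSubobject.mono {X Y X' Y' : A}
    (h : HasCommonNonzeroSubobject X Y) (f : X ⟶ X') [Mono f] (g : Y ⟶ Y') [Mono g] :
    HasCommonNonzeroSubobject X' Y' := by
  obtain ⟨K, hK, ⟨i, hi⟩, ⟨j, hj⟩⟩ := h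
  exact ⟨K, hK, ⟨i ≫ f, mono_comp i f⟩, ⟨j ≫ g, mono_comp j g⟩⟩

variable [Abelian A]

/-- `H` is monoform: it is nonzero and, for every nonzero subobject `L` of `H`, the objects
`H` and `H/L` have no common nonzero subobject. -/
def Monoform (H : A) : Prop :=
  ¬ IsZero H ∧ ∀ (L : A) (i : L ⟶ H) [Mono i], ¬ IsZero L →
    ¬ HasCommonNonzeroSubobject H (cokernel i)

/-- Nonzero subobjects of a monoform object meet nontrivially. -/
lemma Monoform.pullback_not_isZero {H K K' : A} (hH : Monoform H) (i : K ⟶ H) (j : K' ⟶ H)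
    [Mono i] [Mono j] (hK : ¬ IsZero K) (hK' : ¬ IsZero K') : ¬ IsZero (pullback i j) := by
  intro hz
  refine hH.2 K' j hK' ⟨K, hK, ⟨i, inferInstance⟩, ⟨i ≫ cokernel.π j, ?_⟩⟩
  refine Preadditive.mono_of_cancel_zero _ fun {P} g hg => ?_
  have hg' : (g ≫ i) ≫ cokernel.π j = 0 := by rw [Category.assoc]; exact hg
  have h1 : g ≫ i = Abelian.monoLift j (g ≫ i) hg' ≫ j := (Abelian.monoLift_comp j _ hg').symm
  rw [← pullback.lift_fst _ _ h1, hz.eq_of_tgt (pullback.lift _ _ h1) 0, zero_comp]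

lemma Monoform.map_equivalence {H : A} (hH : Monoform H) {B : Type*} [Category* B] [Abelian B]
    (e : A ≌ B) : Monoform (e.functor.obj H) := by
  refine ⟨fun hz => hH.1 (isZero_of_map e hz), fun L i _ hL hc => ?_⟩
  let u : e.inverse.obj (e.functor.obj H) ⟶ H := e.unitInv.app H
  refine hH.2 (e.inverse.obj L) (e.inverse.map i ≫ u)
    (fun hz => hL (isZero_of_map e.symm hz)) ?_
  have h1 := hc.map_equivalence e.symm
  exact h1.mono u
    ((PreservesCokernel.iso e.inverse i).hom ≫ (cokernelCompIsIso (e.inverse.map i) u).inv)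

variable (A) in
/-- Atom-equivalence of monoform objects: having a common nonzero subobject. -/
def atomSetoid : Setoid {H : A // Monoform H} where
  r H₁ H₂ := HasCommonNonzeroSubobject H₁.1 H₂.1
  iseqv :=
    { refl := fun H => ⟨H.1, H.2.1, ⟨𝟙 _, inferInstance⟩, ⟨𝟙 _, inferInstance⟩⟩
      symm := fun ⟨K, hK, hi, hj⟩ => ⟨K, hK, hj, hi⟩
      trans := by
        rintro H₁ H₂ H₃ ⟨K, hK, ⟨a, ha⟩, ⟨b, hb⟩⟩ ⟨K', hK', ⟨c, hc⟩, ⟨d, hd⟩⟩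
        exact ⟨pullback b c, H₂.2.pullback_not_isZero b c hK hK',
          ⟨pullback.fst b c ≫ a, mono_comp _ _⟩, ⟨pullback.snd b c ≫ d, mono_comp _ _⟩⟩ }

variable (A) in
/-- The atom spectrum: the set of atom-equivalence classes of monoform objects. -/
def AtomSpectrum : Type u := _root_.Quotient (atomSetoid A)

/-- The atom of a monoform object. -/
def atom (H : A) (hH : Monoform H) : AtomSpectrum A := _root_.Quotient.mk (atomSetoid A) ⟨H, hH⟩

/-- The atom support of `M`: the atoms of the monoform subquotients of `M`. -/
def atomSupport (M : A) : Set (AtomSpectrum A) :=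
  {α | ∃ (H : A) (hH : Monoform H), IsSubquotient H M ∧ atom H hH = α}

/-- The topology on the atom spectrum generated by the atom supports of objects. -/
instance : TopologicalSpace (AtomSpectrum A) :=
  TopologicalSpace.generateFrom (Set.range (atomSupport (A := A)))

end Atoms

section Autoequivalences

variable (A : Type u) [Category.{v} A]

/-- Two autoequivalences are identified when their underlying functors are isomorphic. -/
def autoequivSetoid : Setoid (A ≌ A) where
  r e f := Nonempty (e.functor ≅ f.functor)
  iseqv :=
    { refl := fun _ => ⟨Iso.refl _⟩
      symm := fun ⟨i⟩ => ⟨i.symm⟩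
      trans := fun ⟨i⟩ ⟨j⟩ => ⟨i ≪≫ j⟩ }

/-- The isomorphism classes of autoequivalences of `A`. -/
def AutoequivClass : Type (max u v) := _root_.Quotient (autoequivSetoid A)

variable {A}

/-- The isomorphism class of an autoequivalence. -/
def AutoequivClass.mk (e : A ≌ A) : AutoequivClass A := _root_.Quotient.mk (autoequivSetoid A) e

/-- The group structure is composition: the product of the classes of `e` and `f` is the class
of the autoequivalence that applies first `f` and then `e`. -/
instance : Group (AutoequivClass A) where
  mul := _root_.Quotient.map₂ (fun e f => f.trans e)
    (fun _ _ ⟨i⟩ _ _ ⟨j⟩ => ⟨NatIso.hcomp j i⟩)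
  one := AutoequivClass.mk CategoryTheory.Equivalence.refl
  inv := _root_.Quotient.map (fun e => e.symm)
    (fun e f ⟨i⟩ => ⟨e.toAdjunction.rightAdjointUniq (f.toAdjunction.ofNatIsoLeft i.symm)⟩)
  mul_assoc := by
    rintro ⟨e⟩ ⟨f⟩ ⟨g⟩
    exact _root_.Quotient.sound ⟨(Functor.associator _ _ _).symm⟩
  one_mul := by
    rintro ⟨e⟩
    exact _root_.Quotient.sound ⟨Functor.rightUnitor _⟩
  mul_one := by
    rintro ⟨e⟩
    exact _root_.Quotient.sound ⟨Functor.leftUnitor _⟩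
  inv_mul_cancel := by
    rintro ⟨e⟩
    exact _root_.Quotient.sound ⟨e.unitIso.symm⟩

variable [Abelian A]

/-- The class of an autoequivalence `e` sends the atom of `H` to the atom of `e(H)`. -/
instance : MulAction (AutoequivClass A) (AtomSpectrum A) where
  smul := _root_.Quotient.map₂ (fun e H => ⟨e.functor.obj H.1, H.2.map_equivalence e⟩) (by
    rintro e f ⟨i⟩ H₁ H₂ h
    exact (HasCommonNonzeroSubobject.map_equivalence h e).mono (𝟙 _) (i.hom.app H₂.1))
  one_smul := by
    rintro ⟨H⟩
    rfl
  mul_smul := by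
    rintro ⟨e⟩ ⟨f⟩ ⟨H⟩
    rfl

lemma mk_smul_atom (e : A ≌ A) (H : A) (hH : Monoform H) :
    AutoequivClass.mk e • atom H hH = atom (e.functor.obj H) (hH.map_equivalence e) := rfl

/-- For a group `G` acting on `A`, where the action is a group homomorphism `φ` from `G` to the
group of isomorphism classes of autoequivalences, two atoms are identified when they lie in the
same orbit of the induced action of `G` on the atom spectrum. -/
def orbitSetoid {G : Type*} [Group G] (φ : G →* AutoequivClass A) : Setoid (AtomSpectrum A) :=
  letI : MulAction G (AtomSpectrum A) := MulAction.compHom (AtomSpectrum A) φ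
  MulAction.orbitRel G (AtomSpectrum A)

/-- The orbit atom spectrum: the set of orbits of `G` in the atom spectrum. -/
def OrbitAtomSpectrum {G : Type*} [Group G] (φ : G →* AutoequivClass A) : Type u :=
  _root_.Quotient (orbitSetoid φ)

/-- The orbit atom spectrum carries the quotient topology. -/
instance {G : Type*} [Group G] (φ : G →* AutoequivClass A) :
    TopologicalSpace (OrbitAtomSpectrum φ) :=
  TopologicalSpace.coinduced (_root_.Quotient.mk (orbitSetoid φ)) inferInstance

end Autoequivalences

/-- A locally noetherian Grothendieck category: a Grothendieck category with a small generating
set of noetherian objects. -/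
class IsLocallyNoetherianGrothendieck (A : Type u) [Category.{v} A] [Abelian A] : Prop
    extends IsGrothendieckAbelian.{w} A where
  exists_noetherian_generators : ∃ P : ObjectProperty A,
    ObjectProperty.Small.{w} P ∧ P.IsSeparating ∧ P ≤ isNoetherianObject

end OrbitAtom

/-!
A monoform object in an orbit `x` has an atom support whose image in the orbit spectrum is open,
because the quotient map by a group acting by homeomorphisms is open. Hence every orbit `y`
specializing to `x` contains a monoform subquotient of that object.

Among the objects of a given class containing a subquotient of a noetherian object `P`, choose one,
`M`, that embeds into a quotient `P/K` with `K` as large as possible. A subquotient `N` of `M` in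
the same class embeds into a quotient of `P/K`; by maximality this quotient is not proper, which
makes `N` a subobject of `M`. For the class of monoform objects whose orbit is topologically
indistinguishable from `x`, this shows that every such orbit is the orbit of `M`, since a nonzero
subobject of a monoform object has the same atom.

For the counterexample, `ℚˣ` acts on `ℝ` by multiplication; all orbits except `{0}` are dense, so
they cannot be told apart by open sets of the orbit space.
-/

namespace OrbitAtom

section Subquotients

variable {A : Type u} [Category.{v} A]

lemma IsSubquotient.refl (M : A) : IsSubquotient M M :=
  ⟨M, 𝟙 M, 𝟙 M, inferInstance, inferInstance⟩

lemma IsSubquotient.of_mono {X M M' : A} (h : IsSubquotient X M) (f : M ⟶ M') [Mono f] :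
    IsSubquotient X M' := by
  obtain ⟨N, i, p, _, hp⟩ := h
  exact ⟨N, i ≫ f, p, mono_comp i f, hp⟩

lemma IsSubquotient.map_equivalence {X M : A} (h : IsSubquotient X M) {B : Type*} [Category* B]
    (e : A ≌ B) : IsSubquotient (e.functor.obj X) (e.functor.obj M) := by
  obtain ⟨N, i, p, _, _⟩ := h
  exact ⟨e.functor.obj N, e.functor.map i, e.functor.map p, inferInstance, inferInstance⟩

variable [Abelian A]

lemma IsSubquotient.exists_epi_mono {X M Q : A} (h : IsSubquotient X M) (j : M ⟶ Q) [Mono j] :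
    ∃ (Q' : A) (r : Q ⟶ Q') (j' : X ⟶ Q'), Epi r ∧ Mono j' ∧
      (Mono r → ∃ f : X ⟶ M, Mono f) := by
  obtain ⟨N, i, p, _, _⟩ := h
  refine ⟨pushout (i ≫ j) p, pushout.inl _ _, pushout.inr _ _, inferInstance, inferInstance,
    fun _ => ?_⟩
  have : Mono (p ≫ pushout.inr (i ≫ j) p) := by
    rw [← pushout.condition]
    infer_instance
  have : Mono p := mono_of_mono p (pushout.inr (i ≫ j) p)
  have : IsIso p := isIso_of_mono_of_epi p
  exact ⟨inv p ≫ i, inferInstance⟩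

lemma mono_of_kernelSubobject_comp_le {X Y Z : A} (q : X ⟶ Y) [Epi q] (r : Y ⟶ Z)
    (h : kernelSubobject (q ≫ r) ≤ kernelSubobject q) : Mono r := by
  refine Preadditive.mono_of_cancel_zero r fun g hg => ?_
  obtain ⟨_, π, _, g', hg'⟩ := surjective_up_to_refinements_of_epi q g
  have hqr : g' ≫ q ≫ r = 0 := by
    rw [← Category.assoc, ← hg', Category.assoc, hg, comp_zero]
  have hq : g' ≫ q = 0 := (kernelSubobject_factors_iff q g').1
    (Subobject.factors_of_le g' h (kernelSubobject_factors _ _ hqr))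
  rw [← cancel_epi π, hg', hq, comp_zero]

lemma exists_forall_isSubquotient_exists_mono (S : ObjectProperty A) {P M₀ : A}
    [IsNoetherianObject P] (hM₀ : S M₀) (hP : IsSubquotient M₀ P) :
    ∃ M : A, S M ∧ ∀ N : A, S N → IsSubquotient N M → ∃ f : N ⟶ M, Mono f := by
  let kernels : Set (Subobject P) := {K | ∃ (M Q : A) (q : P ⟶ Q) (j : M ⟶ Q),
    S M ∧ Epi q ∧ Mono j ∧ kernelSubobject q = K}
  have kernels_nonempty : kernels.Nonempty := by
    obtain ⟨Q, q, j, hq, hj, -⟩ := hP.exists_epi_mono (𝟙 P)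
    exact ⟨_, M₀, Q, q, j, hM₀, hq, hj, rfl⟩
  obtain ⟨_, ⟨M, Q, q, j, hM, _, _, rfl⟩, maximal⟩ :=
    wellFounded_gt.has_min kernels kernels_nonempty
  refine ⟨M, hM, fun N hN hNM => ?_⟩
  obtain ⟨Q', r, j', _, hj', exists_mono⟩ := hNM.exists_epi_mono j
  have not_lt : ¬ kernelSubobject q < kernelSubobject (q ≫ r) :=
    maximal _ ⟨N, Q', q ≫ r, j', hN, epi_comp q r, hj', rfl⟩
  have ker_eq : kernelSubobject q = kernelSubobject (q ≫ r) :=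
    eq_of_le_of_not_lt (kernelSubobject_comp_le q r) not_lt
  exact exists_mono (mono_of_kernelSubobject_comp_le q r ker_eq.ge)

end Subquotients

section Support

variable {A : Type u} [Category.{v} A] [Abelian A]

lemma Monoform.of_mono {H K : A} (hH : Monoform H) (f : K ⟶ H) [Mono f] (hK : ¬ IsZero K) :
    Monoform K := by
  refine ⟨hK, fun L i _ hL hcommon => hH.2 L (i ≫ f) hL ?_⟩
  have sq : IsPullback i (𝟙 L) f (i ≫ f) :=
    IsPullback.of_vert_isIso_mono ⟨by simp⟩
  have : Mono (cokernel.map i (i ≫ f) (𝟙 L) f sq.w) := Abelian.mono_cokernel_map_of_isPullback sq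
  exact hcommon.mono f (cokernel.map i (i ≫ f) (𝟙 L) f sq.w)

lemma atom_eq_of_mono {H K : A} (hH : Monoform H) (hK : Monoform K) (f : K ⟶ H) [Mono f] :
    atom K hK = atom H hH :=
  _root_.Quotient.sound ⟨K, hK.1, ⟨𝟙 K, inferInstance⟩, ⟨f, inferInstance⟩⟩

lemma atom_surjective (α : AtomSpectrum A) : ∃ (H : A) (hH : Monoform H), atom H hH = α := by
  obtain ⟨⟨H, hH⟩, rfl⟩ := _root_.Quotient.exists_rep α
  exact ⟨H, hH, rfl⟩

lemma atom_mem_atomSupport (H : A) (hH : Monoform H) : atom H hH ∈ atomSupport H :=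
  ⟨H, hH, .refl H, rfl⟩

lemma atomSupport_subset_of_mono {M M' : A} (f : M ⟶ M') [Mono f] :
    atomSupport M ⊆ atomSupport M' := by
  rintro _ ⟨H, hH, hHM, rfl⟩
  exact ⟨H, hH, hHM.of_mono f, rfl⟩

lemma isOpen_atomSupport (M : A) : IsOpen (atomSupport M) :=
  TopologicalSpace.isOpen_generateFrom_of_mem ⟨M, rfl⟩

lemma exists_ne_zero_of_isSeparating {P : ObjectProperty A} (hP : P.IsSeparating) {H : A}
    (hH : ¬ IsZero H) : ∃ (X : A) (f : X ⟶ H), P X ∧ f ≠ 0 := by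
  by_contra! hzero
  refine hH ((IsZero.iff_id_eq_zero H).2 ((Preadditive.isSeparating_iff P).1 hP _ ?_))
  intro X hX f
  rw [Category.comp_id, hzero X f hX]

lemma exists_mem_atomSupport_of_isSeparating {P : ObjectProperty A} (hP : P.IsSeparating)
    (α : AtomSpectrum A) : ∃ X : A, P X ∧ α ∈ atomSupport X := by
  obtain ⟨H, hH, rfl⟩ := atom_surjective α
  obtain ⟨X, f, hX, hf⟩ := exists_ne_zero_of_isSeparating hP hH.1
  have image_nonzero : ¬ IsZero (image f) := fun hz => hf <| by
    rw [← image.fac f, hz.eq_of_src (image.ι f) 0, comp_zero]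
  have image_monoform : Monoform (image f) := hH.of_mono (image.ι f) image_nonzero
  exact ⟨X, hX, image f, image_monoform, ⟨X, 𝟙 X, factorThruImage f, inferInstance, inferInstance⟩,
    atom_eq_of_mono hH image_monoform (image.ι f)⟩

lemma exists_isNoetherianObject_mem_atomSupport [IsLocallyNoetherianGrothendieck.{w} A]
    (α : AtomSpectrum A) : ∃ P : A, IsNoetherianObject P ∧ α ∈ atomSupport P := by
  obtain ⟨P, -, separating, noetherian⟩ :=
    IsLocallyNoetherianGrothendieck.exists_noetherian_generators.{w} (A := A)
  obtain ⟨X, hX, hα⟩ := exists_mem_atomSupport_of_isSeparating separating α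
  exact ⟨X, ⟨noetherian X hX⟩, hα⟩

end Support

section Action

variable {A : Type u} [Category.{v} A] [Abelian A]

lemma mk_smul_mem_atomSupport (e : A ≌ A) {M : A} {α : AtomSpectrum A} (hα : α ∈ atomSupport M) :
    AutoequivClass.mk e • α ∈ atomSupport (e.functor.obj M) := by
  obtain ⟨H, hH, hHM, rfl⟩ := hα
  exact ⟨e.functor.obj H, hH.map_equivalence e, hHM.map_equivalence e, rfl⟩

lemma mk_smul_mem_atomSupport_iff (e : A ≌ A) {M : A} {α : AtomSpectrum A} :
    AutoequivClass.mk e • α ∈ atomSupport M ↔ α ∈ atomSupport (e.inverse.obj M) := by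
  refine ⟨fun hα => ?_, fun hα => ?_⟩
  · rw [← inv_smul_smul (AutoequivClass.mk e) α]
    exact mk_smul_mem_atomSupport e.symm hα
  · exact atomSupport_subset_of_mono (e.counit.app M) (mk_smul_mem_atomSupport e hα)

instance : ContinuousConstSMul (AutoequivClass A) (AtomSpectrum A) where
  continuous_const_smul := by
    rintro ⟨e⟩
    refine continuous_generateFrom_iff.2 ?_
    rintro _ ⟨M, rfl⟩
    have preimage_eq : (AutoequivClass.mk e • ·) ⁻¹' atomSupport M =
        atomSupport (e.inverse.obj M) :=
      Set.ext fun _ => mk_smul_mem_atomSupport_iff e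
    exact preimage_eq ▸ isOpen_atomSupport _

end Action

section Orbits

variable {A : Type u} [Category.{v} A] [Abelian A] {G : Type z} [Group G]
  (φ : G →* AutoequivClass A)

/-- The quotient map from the atom spectrum to the orbit atom spectrum. -/
def orbitMk (α : AtomSpectrum A) : OrbitAtomSpectrum φ := _root_.Quotient.mk (orbitSetoid φ) α

lemma orbitMk_surjective : Function.Surjective (orbitMk φ) := _root_.Quotient.mk_surjective

lemma isOpenMap_orbitMk : IsOpenMap (orbitMk φ) := by
  let : MulAction G (AtomSpectrum A) := MulAction.compHom _ φ
  have : ContinuousConstSMul G (AtomSpectrum A) := ⟨fun g => continuous_const_smul (φ g)⟩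
  exact isOpenMap_quotient_mk'_mul

lemma exists_isSubquotient_of_specializes {M : A} (hM : Monoform M) {y : OrbitAtomSpectrum φ}
    (h : y ⤳ orbitMk φ (atom M hM)) :
    ∃ (N : A) (hN : Monoform N), IsSubquotient N M ∧ orbitMk φ (atom N hN) = y := by
  have mem_image : y ∈ orbitMk φ '' atomSupport M :=
    h.mem_open (isOpenMap_orbitMk φ _ (isOpen_atomSupport M))
      (Set.mem_image_of_mem _ (atom_mem_atomSupport M hM))
  obtain ⟨_, ⟨N, hN, hNM, rfl⟩, rfl⟩ := mem_image
  exact ⟨N, hN, hNM, rfl⟩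

theorem t0Space_orbitAtomSpectrum
    (hA : ∀ α : AtomSpectrum A, ∃ P : A, IsNoetherianObject P ∧ α ∈ atomSupport P) :
    T0Space (OrbitAtomSpectrum φ) := by
  refine ⟨fun x y hxy => ?_⟩
  let S : ObjectProperty A := fun M => ∃ hM : Monoform M, Inseparable (orbitMk φ (atom M hM)) x
  obtain ⟨M, ⟨hM, hMx⟩, hmin⟩ :
      ∃ M : A, S M ∧ ∀ N : A, S N → IsSubquotient N M → ∃ f : N ⟶ M, Mono f := by
    obtain ⟨α, rfl⟩ := orbitMk_surjective φ x
    obtain ⟨P, _, H, hH, hHP, rfl⟩ := hA α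
    exact exists_forall_isSubquotient_exists_mono S ⟨hH, .rfl⟩ hHP
  have eq_orbit_M {z : OrbitAtomSpectrum φ} (hz : Inseparable z x) :
      z = orbitMk φ (atom M hM) := by
    obtain ⟨N, hN, hNM, rfl⟩ :=
      exists_isSubquotient_of_specializes φ hM (hz.trans hMx.symm).specializes
    obtain ⟨f, _⟩ := hmin N ⟨hN, hz⟩ hNM
    rw [atom_eq_of_mono hM hN f]
  exact (eq_orbit_M .rfl).trans (eq_orbit_M hxy.symm).symm

end Orbits

section DenseOrbits

lemma specializes_quotient_mk_of_dense_orbit {G X : Type*} [Group G] [MulAction G X]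
    [TopologicalSpace X] {x : X} (hx : Dense (MulAction.orbit G x)) (y : X) :
    (_root_.Quotient.mk _ x : MulAction.orbitRel.Quotient G X) ⤳ _root_.Quotient.mk _ y := by
  refine specializes_iff_forall_open.2 fun U hU hy => ?_
  obtain ⟨_, hgU, g, rfl⟩ :=
    hx.inter_open_nonempty _ (hU.preimage continuous_quotient_mk') ⟨y, hy⟩
  have mk_smul : (_root_.Quotient.mk _ (g • x) : MulAction.orbitRel.Quotient G X) =
      _root_.Quotient.mk _ x := _root_.Quotient.sound ⟨g, rfl⟩
  exact mk_smul ▸ hgU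

lemma dense_orbit_units_rat {x : ℝ} (hx : x ≠ 0) : Dense (MulAction.orbit ℚˣ x) := by
  have dense_multiples : DenseRange fun q : ℚ => (q : ℝ) * x :=
    (Homeomorph.mulRight₀ x hx).surjective.denseRange.comp Rat.denseRange_cast (by fun_prop)
  refine (dense_multiples.dense_image (by fun_prop) (dense_compl_singleton 0)).mono ?_
  rintro _ ⟨q, hq, rfl⟩
  exact ⟨Units.mk0 q hq, Rat.smul_def q x⟩

lemma not_t0Space_real_quotient_units_rat :
    ¬ T0Space (MulAction.orbitRel.Quotient ℚˣ ℝ) := by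
  intro _
  have mk_eq : (_root_.Quotient.mk _ √2 : MulAction.orbitRel.Quotient ℚˣ ℝ) =
      _root_.Quotient.mk _ 1 :=
    ((specializes_quotient_mk_of_dense_orbit (dense_orbit_units_rat (by positivity)) 1).antisymm
      (specializes_quotient_mk_of_dense_orbit (dense_orbit_units_rat one_ne_zero) √2)).eq
  obtain ⟨q, hq⟩ := _root_.Quotient.exact mk_eq
  have sqrt_two_eq : ((q : ℚ) : ℝ) = √2 := by simpa [Units.smul_def, Rat.smul_def] using hq
  exact irrational_sqrt_two ⟨q, sqrt_two_eq⟩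

end DenseOrbits

end OrbitAtom

theorem mainTheorem9_general (A : Type u) [Category.{v} A] [Abelian A]
    (hA : ∀ α : OrbitAtom.AtomSpectrum A, ∃ P : A, IsNoetherianObject P ∧
      α ∈ OrbitAtom.atomSupport P)
    (G : Type z) [Group G] (φ : G →* OrbitAtom.AutoequivClass A) :
    T0Space (OrbitAtom.OrbitAtomSpectrum φ) ∧
    (∃ (X : Type) (_ : TopologicalSpace X) (H : Type) (_ : Group H) (_ : MulAction H X),
      T0Space X ∧ ContinuousConstSMul H X ∧
        ¬ T0Space (MulAction.orbitRel.Quotient H X)) :=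
  ⟨OrbitAtom.t0Space_orbitAtomSpectrum φ hA, ℝ, inferInstance, ℚˣ, inferInstance, inferInstance,
    inferInstance, inferInstance, OrbitAtom.not_t0Space_real_quotient_units_rat⟩

theorem mainTheorem9 (A : Type u) [Category.{v} A] [Abelian A]
    [OrbitAtom.IsLocallyNoetherianGrothendieck.{w} A]
    (G : Type z) [Group G] (φ : G →* OrbitAtom.AutoequivClass A) :
    T0Space (OrbitAtom.OrbitAtomSpectrum φ) ∧
    (∃ (X : Type) (_ : TopologicalSpace X) (H : Type) (_ : Group H) (_ : MulAction H X),
      T0Space X ∧ ContinuousConstSMul H X ∧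
        ¬ T0Space (MulAction.orbitRel.Quotient H X)) :=
  mainTheorem9_general A OrbitAtom.exists_isNoetherianObject_mem_atomSupport.{w} G φ
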